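/- Fix $c\in(0,\infty)$, $r\in(0,1)$, $s>0$ and $t\ge 0$, and let $H_t=(1-r)\,\delta_t+r\,\delta_{s+t}$. Let $F_t$ be the (generalized Marchenko--Pastur) probability distribution on $\mathbb{R}$ determined by $c$ and $H_t$, that is, the one whose Cauchy transform $G_t(z)=\int_{\mathbb R}\frac{1}{z-x}\,dF_t(x)$ satisfies, for every $z\in\mathbb{C}^+=\{\operatorname{Im}z>0\}$, $$G_t(z)=\int_{\mathbb R}\frac{1}{z-x\,(1-c+czG_t(z))}\,dH_t(x)=\frac{1-r}{z-t(1-c+czG_t(z))}+\frac{r}{z-(t+s)(1-c+czG_t(z))}$$ and $\operatorname{Im}\bigl(\frac{1-c}{z}+cG_t(z)\bigr)<0$. Put $a_{t,z}=t(1-c)-z$, $b_{t,z}=(t+s)(1-c)-z$ and $$P_{t,z}(G)=A_{t,z}G^3+B_{t,z}G^2+C_{t,z}G+D_{t,z},$$ where $A_{t,z}=t(t+s)c^2z^2$, $B_{t,z}=a_{t,z}(t+s)cz+b_{t,z}tcz$, $C_{t,z}=rtcz+(1-r)(t+s)cz+a_{t,z}b_{t,z}$, $D_{t,z}=ra_{t,z}+(1-r)b_{t,z}$.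 Let $\Delta_t$ be the real polynomial $$\Delta_t(x)=18A_{t,x}B_{t,x}C_{t,x}D_{t,x}-4B_{t,x}^3D_{t,x}+B_{t,x}^2C_{t,x}^2-4A_{t,x}C_{t,x}^3-27A_{t,x}^2D_{t,x}^2 .$$ Then $P_{t,z}(G_t(z))=0$ for every $z\in\mathbb{C}^+$. If $t>0$ and $c\le 1$, the support of $F_t$ is the closure of $\{x\in[0,\infty):\Delta_t(x)<0\}$. In the remaining cases ($t=0$ or $c>1$) the support of $F_t$ is $\{0\}\cup\overline{\{x\in[0,\infty):\Delta_t(x)<0\}}$. -/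

import Mathlib

open MeasureTheory

noncomputable section

/-- The Cauchy transform `G(z) = ∫ 1 / (z - x) dF(x)` of a distribution `F` on the real line. -/
def cauchyTransform (F : Measure ℝ) (z : ℂ) : ℂ :=
  ∫ x : ℝ, 1 / (z - (x : ℂ)) ∂F

/-- `F` is the generalized Marchenko-Pastur distribution `F^{c,H}` with ratio `c` and population
distribution `H`: a probability distribution on the real line whose Cauchy transform `G` satisfies,
for each `z` in the open upper half-plane,
`G(z) = ∫ 1 / (z - x (1 - c + c z G(z))) dH(x)` and `(1 - c) / z + c G(z) ∈ ℂ⁻`.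
That these two conditions leave only one possible value of `G(z)` is not part of the definition. -/
structure IsMarchenkoPastur (c : ℝ) (H F : Measure ℝ) : Prop where
  isProbabilityMeasure : IsProbabilityMeasure F
  mem_domain : ∀ z : ℂ, 0 < z.im →
    ((1 - (c : ℂ)) / z + (c : ℂ) * cauchyTransform F z).im < 0
  equation : ∀ z : ℂ, 0 < z.im →
    cauchyTransform F z =
      ∫ x : ℝ, 1 / (z - (x : ℂ) * (1 - (c : ℂ) + (c : ℂ) * z * cauchyTransform F z)) ∂H

/-- The two-point population distribution `H_t = (1 - r) δ_t + r δ_{s + t}`. -/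
def populationLaw (r s t : ℝ) : Measure ℝ :=
  ENNReal.ofReal (1 - r) • Measure.dirac t + ENNReal.ofReal r • Measure.dirac (s + t)

/-- The cubic `P_{t,z}(G) = A G³ + B G² + C G + D`, with `u = t (1 - c) - z` and
`v = (t + s) (1 - c) - z`, over an arbitrary commutative ring. It is used over `ℂ` (for the cubic
itself) and over `ℝ[X]` with `z = X` (for its discriminant as a real polynomial). -/
def mpCubic {R : Type*} [CommRing R] (c r s t z : R) : Cubic R :=
  let u := t * (1 - c) - z
  let v := (t + s) * (1 - c) - z
  { a := t * (t + s) * c ^ 2 * z ^ 2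
    b := u * (t + s) * c * z + v * t * c * z
    c := r * t * c * z + (1 - r) * (t + s) * c * z + u * v
    d := r * u + (1 - r) * v }

/-- The discriminant `Δ_t` of the cubic `P_{t,x}`, as a real polynomial in `x`. -/
def discrPoly (c r s t : ℝ) : Polynomial ℝ :=
  (mpCubic (Polynomial.C c) (Polynomial.C r) (Polynomial.C s) (Polynomial.C t)
    Polynomial.X).discr

/-- The value of `Δ_t` at `x` is the usual expression in the coefficients of `P_{t,x}`. -/
theorem discrPoly_eval (c r s t x : ℝ) :
    (discrPoly c r s t).eval x =
      18 * (mpCubic c r s t x).a * (mpCubic c r s t x).b * (mpCubic c r s t x).c *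
          (mpCubic c r s t x).d
        - 4 * (mpCubic c r s t x).b ^ 3 * (mpCubic c r s t x).d
        + (mpCubic c r s t x).b ^ 2 * (mpCubic c r s t x).c ^ 2
        - 4 * (mpCubic c r s t x).a * (mpCubic c r s t x).c ^ 3
        - 27 * (mpCubic c r s t x).a ^ 2 * (mpCubic c r s t x).d ^ 2 := by
  simp [discrPoly, mpCubic, Cubic.discr]
  ring

end

/-! Put W = 1 - c + c z G and q = W / z. Since Im q < 0, the denominators z - t W and z - (s + t) W
do not vanish, and clearing them gives the cubic. Near a real x ≠ 0 its roots stay bounded, so G(z)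
accumulates only at roots of the real cubic P_{t,x} (`exists_subseq_tendsto_cauchyTransform`).

Where Δ_t ≥ 0 these roots are real. By compactness Im G tends to 0 uniformly over intervals avoiding
0, and F has no mass there (`measure_Ioc_eq_zero`). This covers all x < 0
(`discrPoly_eval_nonneg_of_neg`).

Conversely, let Δ_t(x) < 0 with x > 0. If x had an F-null neighbourhood, G would have a real limit
point above x, a real root of P_{t,x}. For t = 0 there is no such root. For t > 0, solve the
equation for z: z = 1/q + c(1-r)t/(1-tq) + cr(s+t)/(1-(s+t)q). Imaginary parts give
`normSq_mpFactor_le`, whose limit says dz/dq ≤ 0 at that root. But the root is simple and lies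
between the poles W = x/(s+t) and W = x/t, which forces dz/dq > 0 (`mpCubic_eval_ne_zero_of_le`).

The origin is settled by the limit of z G(z) up the imaginary axis, which is F({0}): the equation
excludes an atom if t > 0 and c ≤ 1, and forces one otherwise. -/

open Filter Topology Set

/-! ### The equation, its cubic, and the bound from imaginary parts -/

/-- The factor `1 - c + c z G(z)` that multiplies the population variable in the
Marchenko-Pastur equation. -/
noncomputable def mpFactor (c : ℝ) (F : Measure ℝ) (z : ℂ) : ℂ :=
  1 - c + c * z * cauchyTransform F z

theorem mpCubic_toPoly_eval {R : Type*} [CommRing R] (c r s t z y : R) :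
    (mpCubic c r s t z).toPoly.eval y =
      (z - t * (1 - c + c * z * y)) * (z - (s + t) * (1 - c + c * z * y)) * y
        - (1 - r) * (z - (s + t) * (1 - c + c * z * y))
        - r * (z - t * (1 - c + c * z * y)) := by
  simp [Cubic.toPoly, mpCubic]
  ring

theorem integral_populationLaw {r s t : ℝ} (hr0 : 0 ≤ r) (hr1 : r ≤ 1) (f : ℝ → ℂ) :
    ∫ x, f x ∂(populationLaw r s t) = (1 - r) * f t + r * f (s + t) := by
  have h (a : ℝ) (x : ℝ) : Integrable f (ENNReal.ofReal a • Measure.dirac x) :=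
    (integrable_dirac (by simp)).smul_measure ENNReal.ofReal_ne_top
  rw [populationLaw, integral_add_measure (h _ _) (h _ _), integral_smul_measure,
    integral_smul_measure, integral_dirac, integral_dirac, ENNReal.toReal_ofReal (by linarith),
    ENNReal.toReal_ofReal hr0]
  simp

namespace IsMarchenkoPastur

variable {c r s t : ℝ} {F : Measure ℝ} {z : ℂ}

theorem mpFactor_div_im_neg {H : Measure ℝ} (hF : IsMarchenkoPastur c H F) (hz : 0 < z.im) :
    (mpFactor c F z / z).im < 0 := by
  have hz0 : z ≠ 0 := by rintro rfl; simp at hz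
  have := hF.mem_domain z hz
  rwa [show (1 - (c : ℂ)) / z + (c : ℂ) * cauchyTransform F z = mpFactor c F z / z by
    rw [mpFactor]; field_simp] at this

/-- Dividing by z turns the expression into 1 - x q with x real and Im q < 0. -/
theorem sub_mul_mpFactor_ne_zero {H : Measure ℝ} (hF : IsMarchenkoPastur c H F) (hz : 0 < z.im)
    (x : ℝ) : z - x * mpFactor c F z ≠ 0 := by
  have hz0 : z ≠ 0 := by rintro rfl; simp at hz
  intro h
  have h1 : 1 - x * (mpFactor c F z / z) = 0 := by
    rw [mul_div_assoc', one_sub_div hz0, h, zero_div]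
  have h2 := congrArg Complex.im h1
  have h3 := hF.mpFactor_div_im_neg hz
  rcases eq_or_ne x 0 with rfl | hx
  · simp at h1
  · simp only [Complex.sub_im, Complex.one_im, Complex.im_ofReal_mul, zero_sub, Complex.zero_im,
      neg_eq_zero, mul_eq_zero, hx, false_or] at h2
    exact h3.ne h2

theorem cauchyTransform_eq (hF : IsMarchenkoPastur c (populationLaw r s t) F) (hr0 : 0 ≤ r)
    (hr1 : r ≤ 1) (hz : 0 < z.im) :
    cauchyTransform F z =
      (1 - r) / (z - t * mpFactor c F z) + r / (z - (s + t) * mpFactor c F z) := by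
  rw [hF.equation z hz, integral_populationLaw hr0 hr1]
  simp only [mpFactor, Complex.ofReal_add]
  ring

theorem eval_cauchyTransform (hF : IsMarchenkoPastur c (populationLaw r s t) F) (hr0 : 0 ≤ r)
    (hr1 : r ≤ 1) (hz : 0 < z.im) :
    (mpCubic (c : ℂ) r s t z).toPoly.eval (cauchyTransform F z) = 0 := by
  have h1 := hF.sub_mul_mpFactor_ne_zero hz t
  have h2 := hF.sub_mul_mpFactor_ne_zero hz (s + t)
  have h := hF.cauchyTransform_eq hr0 hr1 hz
  rw [mpCubic_toPoly_eval]
  change (z - t * mpFactor c F z) * (z - (s + t) * mpFactor c F z) * _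
    - (1 - r) * (z - (s + t) * mpFactor c F z) - r * (z - t * mpFactor c F z) = 0
  push_cast at h2
  rw [h]
  generalize z - t * mpFactor c F z = d at *
  generalize z - (s + t) * mpFactor c F z = e at *
  field_simp
  ring

/-- Comparing imaginary parts in the equation solved for `z` bounds the factor `1 - c + c z G`. -/
theorem normSq_mpFactor_le (hF : IsMarchenkoPastur c (populationLaw r s t) F) (hr0 : 0 ≤ r)
    (hr1 : r ≤ 1) (hz : 0 < z.im) :
    c * Complex.normSq (mpFactor c F z) *
        ((1 - r) * t ^ 2 * Complex.normSq (z - (s + t) * mpFactor c F z)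
          + r * (s + t) ^ 2 * Complex.normSq (z - t * mpFactor c F z)) ≤
      Complex.normSq (z - t * mpFactor c F z)
        * Complex.normSq (z - (s + t) * mpFactor c F z) := by
  have hz0 : z ≠ 0 := by rintro rfl; simp at hz
  have h1 := hF.sub_mul_mpFactor_ne_zero hz t
  have h2 := hF.sub_mul_mpFactor_ne_zero hz (s + t)
  have h := hF.cauchyTransform_eq hr0 hr1 hz
  have him := hF.mpFactor_div_im_neg hz
  have hW : mpFactor c F z = 1 - c + c * z * cauchyTransform F z := rfl
  push_cast at h2
  set q := mpFactor c F z / z with hq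
  have hWq : mpFactor c F z = z * q := by rw [hq]; field_simp
  have e1 : z - t * mpFactor c F z = z * (1 - t * q) := by rw [hWq]; ring
  have e2 : z - (s + t) * mpFactor c F z = z * (1 - (s + t) * q) := by rw [hWq]; ring
  rw [e1] at h1
  rw [e2] at h2
  have h1' := right_ne_zero_of_mul h1
  have h2' := right_ne_zero_of_mul h2
  have hq0 : q ≠ 0 := by intro h0; rw [h0] at him; simp at him
  have key : z = q⁻¹ + (c * (1 - r) * t : ℝ) * (1 - t * q)⁻¹
      + (c * r * (s + t) : ℝ) * (1 - (s + t) * q)⁻¹ := by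
    rw [h, e1, e2, hWq] at hW
    obtain ⟨d, hd⟩ : ∃ d, d = 1 - t * q := ⟨_, rfl⟩
    obtain ⟨e, he⟩ : ∃ e, e = 1 - (s + t) * q := ⟨_, rfl⟩
    rw [← hd, ← he] at hW ⊢
    rw [← hd] at h1'
    rw [← he] at h2'
    apply mul_right_cancel₀ hq0
    rw [hW, add_mul, add_mul, inv_mul_cancel₀ hq0]
    have hd' : t * q = 1 - d := by rw [hd]; ring
    have he' : (s + t) * q = 1 - e := by rw [he]; ring
    have a1 : ((c * (1 - r) * t : ℝ) : ℂ) * d⁻¹ * q = c * (1 - r) * (1 - d) * d⁻¹ := by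
      rw [← hd']; push_cast; ring
    have a2 : ((c * r * (s + t) : ℝ) : ℂ) * e⁻¹ * q = c * r * (1 - e) * e⁻¹ := by
      rw [← he']; push_cast; ring
    rw [a1, a2]
    field_simp
    ring
  have kim := congrArg Complex.im key
  simp only [Complex.add_im, Complex.im_ofReal_mul, Complex.inv_im] at kim
  have i1 : (1 - t * q : ℂ).im = - t * q.im := by simp
  have i2 : (1 - (s + t) * q : ℂ).im = - (s + t) * q.im := by
    rw [← Complex.ofReal_add]; simp only [Complex.sub_im, Complex.im_ofReal_mul]; simp; ring
  rw [i1, i2] at kim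
  rw [e1, e2, hWq]
  simp only [Complex.normSq_mul]
  have p0 := Complex.normSq_pos.2 hq0
  have p1 := Complex.normSq_pos.2 h1'
  have p2 := Complex.normSq_pos.2 h2'
  have pz := Complex.normSq_pos.2 hz0
  set N := Complex.normSq q
  set N1 := Complex.normSq (1 - t * q)
  set N2 := Complex.normSq (1 - (s + t) * q)
  set Z := Complex.normSq z
  -- `kim` with denominators cleared. As z.im and -q.im are positive, so is the bracket; it is
  -- -dz/dq with squares replaced by squared moduli.
  have kk : z.im * (N * N1 * N2) = -q.im *
      (N1 * N2 - c * N * ((1 - r) * t ^ 2 * N2 + r * (s + t) ^ 2 * N1)) := by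
    rw [kim]; field_simp; ring
  have : 0 < N1 * N2 - c * N * ((1 - r) * t ^ 2 * N2 + r * (s + t) ^ 2 * N1) := by
    refine pos_of_mul_pos_right (a := -q.im) ?_ (by linarith)
    rw [← kk]; positivity
  -- Passing from q back to W = z q multiplies the inequality by Z ^ 2.
  nlinarith [mul_pos (mul_pos pz pz) this]

end IsMarchenkoPastur

/-! ### Real cubics and the sign of the discriminant -/

theorem eval_discrPoly_eq_discr (c r s t x : ℝ) :
    (discrPoly c r s t).eval x = (mpCubic c r s t x).discr := by
  rw [discrPoly_eval, Cubic.discr]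
  ring

theorem Cubic.eval_toPoly {R : Type*} [CommRing R] (P : Cubic R) (y : R) :
    P.toPoly.eval y = P.a * y ^ 3 + P.b * y ^ 2 + P.c * y + P.d := by
  simp [Cubic.toPoly]

theorem mpCubic_map_ofReal (c r s t x : ℝ) :
    mpCubic (c : ℂ) r s t x = (mpCubic c r s t x).map Complex.ofRealHom := by
  simp [mpCubic, Cubic.map]

theorem mpCubic_a_zero {R : Type*} [CommRing R] (c r s z : R) : (mpCubic c r s 0 z).a = 0 := by
  simp [mpCubic]

theorem mpCubic_b_zero {R : Type*} [CommRing R] (c r s z : R) :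
    (mpCubic c r s 0 z).b = -(s * c * z ^ 2) := by
  simp [mpCubic]
  ring

/-- A real polynomial of degree three has a real root. -/
theorem Cubic.exists_real_root {P : Cubic ℝ} (ha : P.a ≠ 0) :
    ∃ g, P.a * g ^ 3 + P.b * g ^ 2 + P.c * g + P.d = 0 := by
  -- Cauchy's root bound: at ±N the leading term dominates, so the values there have opposite signs.
  set N : ℝ := 1 + (|P.b| + |P.c| + |P.d|) / |P.a| with hN
  have ha' : 0 < |P.a| := abs_pos.2 ha
  have hN1 : 1 ≤ N := by rw [hN]; have : 0 ≤ (|P.b| + |P.c| + |P.d|) / |P.a| := by positivity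
                         linarith
  have hNa : |P.a| * N = |P.a| + (|P.b| + |P.c| + |P.d|) := by rw [hN]; field_simp
  have hbig (y : ℝ) (hy : |y| = N) :
      |P.b * y ^ 2 + P.c * y + P.d| < |P.a| * N ^ 3 := by
    have h1 : |P.b * y ^ 2 + P.c * y + P.d| ≤ |P.b| * N ^ 2 + |P.c| * N + |P.d| := by
      refine (abs_add_le _ _).trans (add_le_add ((abs_add_le _ _).trans (add_le_add ?_ ?_)) le_rfl)
      · rw [abs_mul, abs_pow, hy]
      · rw [abs_mul, hy]
    have h2 : N ≤ N ^ 2 := by nlinarith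
    have h3 : 1 ≤ N ^ 2 := by nlinarith
    have h4 := mul_le_mul_of_nonneg_left h2 (abs_nonneg P.c)
    have h5 := mul_le_mul_of_nonneg_left h3 (abs_nonneg P.d)
    have h6 : |P.a| * N ^ 3 = (|P.a| + (|P.b| + |P.c| + |P.d|)) * N ^ 2 := by rw [← hNa]; ring
    have h7 : 0 < |P.a| * N ^ 2 := by positivity
    rw [h6]
    nlinarith
  have hcont : Continuous fun y : ℝ ↦ P.a * y ^ 3 + P.b * y ^ 2 + P.c * y + P.d := by fun_prop
  have hp := abs_lt.1 (hbig N (abs_of_nonneg (by linarith)))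
  have hm := abs_lt.1 (hbig (-N) (by rw [abs_neg, abs_of_nonneg (by linarith)]))
  rcases lt_or_gt_of_ne ha with h | h
  · rw [abs_of_neg h] at hp hm
    exact mem_range_of_exists_le_of_exists_ge hcont
      ⟨N, by linarith [hp.2]⟩ ⟨-N, by rw [show (-N) ^ 3 = -N ^ 3 by ring]; linarith [hm.1]⟩
  · rw [abs_of_pos h] at hp hm
    exact mem_range_of_exists_le_of_exists_ge hcont
      ⟨-N, by rw [show (-N) ^ 3 = -N ^ 3 by ring]; linarith [hm.2]⟩ ⟨N, by linarith [hp.1]⟩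

/-- A real cubic is the product of a linear and a quadratic factor. -/
theorem Cubic.exists_factor {P : Cubic ℝ} (ha : P.a ≠ 0) :
    ∃ g p q, P.b = P.a * (p - g) ∧ P.c = P.a * (q - g * p) ∧ P.d = -(P.a * g * q) ∧
      P.discr = P.a ^ 4 * (p ^ 2 - 4 * q) * (g ^ 2 + p * g + q) ^ 2 := by
  obtain ⟨g, hg⟩ := Cubic.exists_real_root ha
  have hb : P.b = P.a * ((P.b / P.a + g) - g) := by field_simp; ring
  have hc : P.c = P.a * ((P.c / P.a + g * (P.b / P.a + g)) - g * (P.b / P.a + g)) := by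
    field_simp; ring
  have hd : P.d = -(P.a * g * (P.c / P.a + g * (P.b / P.a + g))) := by
    field_simp; linear_combination hg
  refine ⟨g, P.b / P.a + g, P.c / P.a + g * (P.b / P.a + g), hb, hc, hd, ?_⟩
  generalize P.b / P.a + g = p at *
  generalize P.c / P.a + g * p = q at *
  rw [Cubic.discr, hb, hc, hd]
  ring

theorem Complex.im_eq_zero_of_sq_eq_ofReal {u : ℂ} {D : ℝ} (hD : 0 ≤ D) (h : u ^ 2 = D) :
    u.im = 0 := by
  have h1 := congrArg Complex.re h
  have h2 := congrArg Complex.im h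
  simp only [pow_two, Complex.mul_re, Complex.mul_im, Complex.ofReal_re, Complex.ofReal_im] at h1 h2
  have h3 : u.re * u.im = 0 := by linarith
  rcases mul_eq_zero.1 h3 with h | h
  · rw [h] at h1
    nlinarith
  · exact h

/-- The roots of a real polynomial of degree two or three with nonnegative cubic discriminant are
real. -/
theorem Cubic.im_root_eq_zero {P : Cubic ℝ} (hab : P.a ≠ 0 ∨ P.b ≠ 0) (hP : 0 ≤ P.discr) {y : ℂ}
    (hy : (P.map Complex.ofRealHom).toPoly.eval y = 0) : y.im = 0 := by
  rw [Cubic.eval_toPoly] at hy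
  simp only [Cubic.map, Complex.ofRealHom_eq_coe] at hy
  by_cases ha : P.a = 0
  · have hb : P.b ≠ 0 := by tauto
    have hb2 : 0 < P.b ^ 2 := by positivity
    have hD : 0 ≤ P.c ^ 2 - 4 * P.b * P.d := by
      rw [Cubic.discr, ha] at hP
      refine nonneg_of_mul_nonneg_right (a := P.b ^ 2) ?_ hb2
      linarith
    rw [ha] at hy
    have h := Complex.im_eq_zero_of_sq_eq_ofReal (u := 2 * P.b * y + P.c) hD
      (by push_cast at hy ⊢; linear_combination 4 * P.b * hy)
    simpa [hb] using h
  · obtain ⟨g, p, q, hb, hc, hd, hdisc⟩ := Cubic.exists_factor ha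
    have hac : (P.a : ℂ) ≠ 0 := by exact_mod_cast ha
    have hfac : (P.a : ℂ) * ((y - g) * (y ^ 2 + p * y + q)) = 0 := by
      rw [← hy, hb, hc, hd]; push_cast; ring
    have := (mul_eq_zero.1 hfac).resolve_left hac
    rcases mul_eq_zero.1 this with h | h
    · rw [sub_eq_zero.1 h]; simp
    · have hD : 0 ≤ p ^ 2 - 4 * q := by
        -- Otherwise the quadratic factor is positive at g and the discriminant formula gives a
        -- negative value.
        by_contra hneg
        have h1 : 0 < g ^ 2 + p * g + q := by nlinarith [sq_nonneg (2 * g + p)]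
        have h2 : 0 < P.a ^ 4 * (g ^ 2 + p * g + q) ^ 2 := by positivity
        nlinarith
      have h := Complex.im_eq_zero_of_sq_eq_ofReal (u := 2 * y + p) hD
        (by push_cast; linear_combination 4 * h)
      simpa using h

/-- A real cubic with negative discriminant has one real root, which is simple. -/
theorem Cubic.exists_unique_root {P : Cubic ℝ} (ha : 0 < P.a) (hP : P.discr < 0) :
    ∃ g, (∀ y, P.toPoly.eval y < 0 → y < g) ∧ (∀ y, 0 < P.toPoly.eval y → g < y) ∧
      (∀ y, P.toPoly.eval y = 0 → y = g) ∧ 0 < 3 * P.a * g ^ 2 + 2 * P.b * g + P.c := by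
  obtain ⟨g, p, q, hb, hc, hd, hdisc⟩ := Cubic.exists_factor ha.ne'
  have hD : p ^ 2 - 4 * q < 0 := by
    by_contra! h
    have : 0 ≤ P.a ^ 4 * (p ^ 2 - 4 * q) * (g ^ 2 + p * g + q) ^ 2 := by positivity
    linarith
  have hq (y : ℝ) : 0 < P.a * (y ^ 2 + p * y + q) :=
    mul_pos ha (by nlinarith [sq_nonneg (2 * y + p)])
  have hfac (y : ℝ) : P.toPoly.eval y = P.a * (y ^ 2 + p * y + q) * (y - g) := by
    rw [Cubic.eval_toPoly, hb, hc, hd]; ring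
  refine ⟨g, fun y h ↦ ?_, fun y h ↦ ?_, fun y h ↦ ?_, ?_⟩
  · rw [hfac] at h
    linarith [neg_of_mul_neg_right h (hq y).le]
  · rw [hfac] at h
    linarith [pos_of_mul_pos_right h (hq y).le]
  · rw [hfac] at h
    linarith [(mul_eq_zero.1 h).resolve_left (hq y).ne']
  · have := hq g
    rw [hb, hc]
    linarith

/-! ### Signs of the cubic at the two poles -/

/-- The argument is the y at which 1 - c + c x y = x / t, the pole of the first fraction, so only
one term of the cubic survives. The sign of this value, with that at the other pole, locates a
unique real root. -/
theorem mpCubic_eval_of_factor_eq {c r s t x : ℝ} (hc : 0 < c) (ht : 0 < t) (hx : x ≠ 0) :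
    (mpCubic c r s t x).toPoly.eval ((x / t - (1 - c)) / (c * x)) = (1 - r) * s / t * x := by
  rw [mpCubic_toPoly_eval]
  have : c * x * ((x / t - (1 - c)) / (c * x)) = x / t - (1 - c) := by field_simp
  rw [this]
  field_simp
  ring

theorem mpCubic_eval_of_factor_eq' {c r s t x : ℝ} (hc : 0 < c) (hst : 0 < s + t) (hx : x ≠ 0) :
    (mpCubic c r s t x).toPoly.eval ((x / (s + t) - (1 - c)) / (c * x)) =
      -(r * s / (s + t) * x) := by
  rw [mpCubic_toPoly_eval]
  have : c * x * ((x / (s + t) - (1 - c)) / (c * x)) = x / (s + t) - (1 - c) := by field_simp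
  rw [this]
  field_simp
  ring

theorem mpCubic_a_pos {c r s t x : ℝ} (hc : 0 < c) (hs : 0 < s) (ht : 0 < t) (hx : x ≠ 0) :
    0 < (mpCubic c r s t x).a := by
  simp only [mpCubic]
  positivity

theorem mpCubic_a_or_b_ne_zero {c r s t x : ℝ} (hc : 0 < c) (hs : 0 < s) (ht : 0 ≤ t)
    (hx : x ≠ 0) : (mpCubic c r s t x).a ≠ 0 ∨ (mpCubic c r s t x).b ≠ 0 := by
  rcases ht.eq_or_lt with rfl | ht
  · right
    rw [mpCubic_b_zero]
    have : 0 < s * c * x ^ 2 := by positivity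
    linarith
  · exact Or.inl (mpCubic_a_pos hc hs ht hx).ne'

/-- A negative discriminant would leave one real root. For t > 0 and x < 0 the signs at the two
poles would place it between them in an order opposite to their actual one. For t = 0 the
discriminant is explicit. -/
theorem discrPoly_eval_nonneg_of_neg {c r s t x : ℝ} (hc : 0 < c) (hr0 : 0 < r) (hr1 : r < 1)
    (hs : 0 < s) (ht : 0 ≤ t) (hx : x < 0) : 0 ≤ (discrPoly c r s t).eval x := by
  rcases ht.eq_or_lt with rfl | ht
  · have : (discrPoly c r s 0).eval x = (s * c * x ^ 2) ^ 2 * x ^ 2 *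
        (x ^ 2 - 2 * s * x * (1 + c * r) + s ^ 2 * (1 - c * r) ^ 2) := by
      rw [discrPoly_eval]; simp [mpCubic]; ring
    rw [this]
    have h1 : 0 < s * -x * (1 + c * r) := by
      have : 0 < -x := by linarith
      positivity
    have h2 : 0 ≤ x ^ 2 - 2 * s * x * (1 + c * r) + s ^ 2 * (1 - c * r) ^ 2 := by
      nlinarith [sq_nonneg x, sq_nonneg (s * (1 - c * r))]
    positivity
  · by_contra! h
    rw [eval_discrPoly_eq_discr] at h
    obtain ⟨g, hlt, hgt, -⟩ := Cubic.exists_unique_root (mpCubic_a_pos hc hs ht hx.ne) h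
    have h1 := hlt ((x / t - (1 - c)) / (c * x)) (by
      rw [mpCubic_eval_of_factor_eq hc ht hx.ne]
      have : 0 < (1 - r) * s / t := by have := sub_pos.2 hr1; positivity
      nlinarith)
    have h2 := hgt ((x / (s + t) - (1 - c)) / (c * x)) (by
      rw [mpCubic_eval_of_factor_eq' hc (by linarith) hx.ne]
      have : 0 < r * s / (s + t) := by positivity
      nlinarith)
    have h3 := h1.trans h2
    rw [div_lt_div_right_of_neg (mul_neg_of_pos_of_neg hc hx)] at h3
    have h4 : x / (s + t) < x / t := by linarith
    rw [div_lt_div_iff₀ (by linarith) ht] at h4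
    nlinarith

/-- At a positive point of negative discriminant the real root of the cubic violates the limit of
the bound `IsMarchenkoPastur.normSq_mpFactor_le`. -/
theorem mpCubic_eval_ne_zero_of_le {c r s t x : ℝ} (hc : 0 < c) (hr0 : 0 < r) (hr1 : r < 1)
    (hs : 0 < s) (ht : 0 ≤ t) (hx : 0 < x) (hdisc : (discrPoly c r s t).eval x < 0) {y w : ℝ}
    (hw : w = 1 - c + c * x * y)
    (hle : c * w ^ 2 * ((1 - r) * t ^ 2 * (x - (s + t) * w) ^ 2
        + r * (s + t) ^ 2 * (x - t * w) ^ 2) ≤ (x - t * w) ^ 2 * (x - (s + t) * w) ^ 2) :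
    (mpCubic c r s t x).toPoly.eval y ≠ 0 := by
  intro hy
  rw [eval_discrPoly_eq_discr] at hdisc
  rcases ht.eq_or_lt with rfl | ht
  · rw [Cubic.eval_toPoly, mpCubic_a_zero] at hy
    rw [Cubic.discr, mpCubic_a_zero] at hdisc
    generalize mpCubic c r s 0 x = P at *
    -- For t = 0 the cubic is a quadratic, and a real root makes its discriminant a square.
    have h1 : P.c ^ 2 - 4 * P.b * P.d = (2 * P.b * y + P.c) ^ 2 := by
      linear_combination -4 * P.b * hy
    have h2 : P.b ^ 2 * (P.c ^ 2 - 4 * P.b * P.d) < 0 := by linarith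
    rw [h1] at h2
    have : 0 ≤ P.b ^ 2 * (2 * P.b * y + P.c) ^ 2 := by positivity
    linarith
  · obtain ⟨g, hlt, hgt, hroot, hder⟩ :=
      Cubic.exists_unique_root (mpCubic_a_pos hc hs ht hx.ne') hdisc
    obtain rfl := hroot y hy
    have hst : 0 < s + t := by linarith
    have h1 := hgt ((x / t - (1 - c)) / (c * x)) (by
      rw [mpCubic_eval_of_factor_eq hc ht hx.ne']
      have := sub_pos.2 hr1; positivity)
    have h2 := hlt ((x / (s + t) - (1 - c)) / (c * x)) (by
      rw [mpCubic_eval_of_factor_eq' hc hst hx.ne']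
      have : 0 < r * s / (s + t) * x := by positivity
      linarith)
    rw [lt_div_iff₀ (by positivity)] at h1
    rw [div_lt_iff₀ (by positivity)] at h2
    have h3 : w < x / t := by rw [hw]; linarith
    have h4 : x / (s + t) < w := by rw [hw]; linarith
    have hw0 : 0 < w := lt_trans (by positivity) h4
    rw [lt_div_iff₀ ht] at h3
    rw [div_lt_iff₀ hst] at h4
    have hU : 0 < x - t * w := by linarith
    have hV : 0 < (s + t) * w - x := by linarith
    -- Up to a positive factor, the derivative of the cubic at its root is dz/dq; the right side is
    -- the difference of the two sides of `hle`, while `hder` makes the left side positive.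
    have key : w * ((x - t * w) * ((s + t) * w - x)) *
        (3 * (mpCubic c r s t x).a * y ^ 2 + 2 * (mpCubic c r s t x).b * y
          + (mpCubic c r s t x).c) =
        c * w ^ 2 * ((1 - r) * t ^ 2 * (x - (s + t) * w) ^ 2
          + r * (s + t) ^ 2 * (x - t * w) ^ 2) - (x - t * w) ^ 2 * (x - (s + t) * w) ^ 2 := by
      have hder : 3 * (mpCubic c r s t x).a * y ^ 2 + 2 * (mpCubic c r s t x).b * y
          + (mpCubic c r s t x).c = (x - t * w) * (x - (s + t) * w)
            - (w - 1 + c) * (t * (x - (s + t) * w) + (s + t) * (x - t * w))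
            + c * x * ((1 - r) * (s + t) + r * t) := by
        rw [hw]
        dsimp only [mpCubic]
        ring
      have hE : (x - t * w) * (x - (s + t) * w) * (w - 1 + c)
          - c * x * ((1 - r) * (x - (s + t) * w) + r * (x - t * w)) = 0 := by
        rw [mpCubic_toPoly_eval, ← hw] at hy
        rw [show w - 1 + c = c * x * y by rw [hw]; ring]
        linear_combination c * x * hy
      rw [hder]
      linear_combination (-((x - t * w) * (x - (s + t) * w)
        - w * (t * (x - (s + t) * w) + (s + t) * (x - t * w)))) * hE
    have : 0 < w * ((x - t * w) * ((s + t) * w - x)) *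
        (3 * (mpCubic c r s t x).a * y ^ 2 + 2 * (mpCubic c r s t x).b * y
          + (mpCubic c r s t x).c) := by positivity
    linarith

/-! ### Cauchy transforms and the mass of intervals -/

section CauchyTransform

variable {F : Measure ℝ} [IsProbabilityMeasure F] {z : ℂ}

theorem normSq_sub_ofReal (z : ℂ) (x : ℝ) :
    Complex.normSq (z - x) = (z.re - x) ^ 2 + z.im ^ 2 := by
  rw [Complex.normSq_apply]
  simp
  ring

theorem im_one_div_sub_ofReal (z : ℂ) (x : ℝ) :
    (1 / (z - x) : ℂ).im = -(z.im / ((z.re - x) ^ 2 + z.im ^ 2)) := by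
  rw [one_div, Complex.inv_im, normSq_sub_ofReal]
  simp [neg_div]

theorem re_one_div_sub_ofReal (z : ℂ) (x : ℝ) :
    (1 / (z - x) : ℂ).re = (z.re - x) / ((z.re - x) ^ 2 + z.im ^ 2) := by
  rw [one_div, Complex.inv_re, normSq_sub_ofReal]
  simp

theorem norm_one_div_sub_ofReal_le (hz : 0 < z.im) (x : ℝ) : ‖1 / (z - x : ℂ)‖ ≤ 1 / z.im := by
  rw [norm_div, norm_one]
  refine one_div_le_one_div_of_le hz ?_
  have := Complex.abs_im_le_norm (z - x)
  simp only [Complex.sub_im, Complex.ofReal_im, sub_zero] at this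
  exact (le_abs_self _).trans this

theorem integrable_one_div_sub (hz : 0 < z.im) : Integrable (fun x : ℝ ↦ 1 / (z - x : ℂ)) F :=
  Integrable.of_bound (by measurability) (1 / z.im) (ae_of_all _ (norm_one_div_sub_ofReal_le hz))

theorem integrable_poisson (hz : 0 < z.im) :
    Integrable (fun x : ℝ ↦ z.im / ((z.re - x) ^ 2 + z.im ^ 2)) F := by
  have h := (integrable_one_div_sub (F := F) hz).im.neg
  refine h.congr (ae_of_all _ fun x ↦ ?_)
  have := im_one_div_sub_ofReal z x
  simp only [Pi.neg_apply, RCLike.im_eq_complex_im]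
  rw [this, neg_neg]

theorem cauchyTransform_im (hz : 0 < z.im) :
    (cauchyTransform F z).im = -∫ x, z.im / ((z.re - x) ^ 2 + z.im ^ 2) ∂F := by
  have h := integral_im (𝕜 := ℂ) (integrable_one_div_sub (F := F) hz)
  simp only [RCLike.im_eq_complex_im] at h
  rw [cauchyTransform, ← h, ← integral_neg]
  exact integral_congr_ae (ae_of_all _ fun x ↦ im_one_div_sub_ofReal z x)

theorem cauchyTransform_re (hz : 0 < z.im) :
    (cauchyTransform F z).re = ∫ x, (z.re - x) / ((z.re - x) ^ 2 + z.im ^ 2) ∂F := by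
  have h := integral_re (𝕜 := ℂ) (integrable_one_div_sub (F := F) hz)
  simp only [RCLike.re_eq_complex_re] at h
  rw [cauchyTransform, ← h]
  exact integral_congr_ae (ae_of_all _ fun x ↦ re_one_div_sub_ofReal z x)

/-- The mass of a short interval is controlled by the Cauchy transform above its midpoint. -/
theorem measureReal_Icc_le (hz : 0 < z.im) :
    F.real (Icc (z.re - z.im) (z.re + z.im)) ≤ 2 * z.im * -(cauchyTransform F z).im := by
  rw [cauchyTransform_im hz, neg_neg]
  have h1 : ∫ x, (Icc (z.re - z.im) (z.re + z.im)).indicator (fun _ ↦ 1 / (2 * z.im)) x ∂F ≤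
      ∫ x, z.im / ((z.re - x) ^ 2 + z.im ^ 2) ∂F := by
    refine integral_mono ((integrable_const _).indicator measurableSet_Icc)
      (integrable_poisson hz) fun x ↦ ?_
    by_cases hx : x ∈ Icc (z.re - z.im) (z.re + z.im)
    -- On this interval the Poisson kernel is at least 1 / (2 Im z).
    · simp only [indicator_of_mem hx]
      rw [div_le_div_iff₀ (by positivity) (by positivity)]
      have : (z.re - x) ^ 2 ≤ z.im ^ 2 := sq_le_sq' (by linarith [hx.2]) (by linarith [hx.1])
      nlinarith
    · simp only [indicator_of_notMem hx]
      positivity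
  rw [integral_indicator_const _ measurableSet_Icc, smul_eq_mul] at h1
  have h2 : F.real (Icc (z.re - z.im) (z.re + z.im)) =
      2 * z.im * (F.real (Icc (z.re - z.im) (z.re + z.im)) * (1 / (2 * z.im))) := by field_simp
  rw [h2]
  gcongr

/-- If the imaginary part of the Cauchy transform tends to zero uniformly on an interval, the
interval has no mass. -/
theorem measure_Ioc_eq_zero_of_im_cauchyTransform {a b : ℝ}
    (h : ∀ η > 0, ∃ ε₀ > 0, ∀ z : ℂ, z.re ∈ Icc a b → 0 < z.im → z.im < ε₀ →
      -(cauchyTransform F z).im ≤ η) :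
    F (Ioc a b) = 0 := by
  rcases le_or_gt b a with hab | hab
  · simp [Ioc_eq_empty_of_le hab]
  rw [← measureReal_eq_zero_iff]
  refine le_antisymm (le_of_forall_pos_le_add fun δ hδ ↦ ?_) measureReal_nonneg
  rw [zero_add]
  have hl : 0 < b - a := sub_pos.2 hab
  obtain ⟨ε₀, hε₀, H⟩ := h (δ / (b - a)) (by positivity)
  obtain ⟨n, hn⟩ := exists_nat_gt ((b - a) / ε₀)
  have hn0 : (0 : ℝ) < n := lt_trans (by positivity) hn
  set ε := (b - a) / (2 * n) with hε
  have hεpos : 0 < ε := by positivity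
  have hnε : a + 2 * n * ε = b := by rw [hε]; field_simp; ring
  have hlt : ε < ε₀ := by
    rw [hε, div_lt_iff₀ (by positivity)]
    rw [div_lt_iff₀ hε₀] at hn
    nlinarith
  have step (k : ℕ) (hk : k ≤ n) :
      F.real (Ioc a (a + 2 * k * ε)) ≤ k * (2 * ε * (δ / (b - a))) := by
    induction k with
    | zero => simp
    | succ k ih =>
      have hk1 : ((k + 1 : ℕ) : ℝ) ≤ n := by exact_mod_cast hk
      push_cast at hk1 ⊢
      -- The point above the midpoint of the next piece of (a, b], at a height equal to half the
      -- piece's length.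
      let z : ℂ := ⟨a + (2 * k + 1) * ε, ε⟩
      have hk0 : (0 : ℝ) ≤ k := k.cast_nonneg
      have hz := H z ⟨by change a ≤ a + (2 * k + 1) * ε; nlinarith,
        by change a + (2 * k + 1) * ε ≤ b; rw [← hnε]; nlinarith⟩ hεpos hlt
      have hm := measureReal_Icc_le (F := F) (z := z) hεpos
      have hsub : Ioc a (a + 2 * (k + 1) * ε) ⊆
          Ioc a (a + 2 * k * ε) ∪ Icc (z.re - z.im) (z.re + z.im) := by
        intro y hy
        rcases le_or_gt y (a + 2 * k * ε) with h | h
        · exact Or.inl ⟨hy.1, h⟩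
        · refine Or.inr ⟨?_, ?_⟩
          · change a + (2 * k + 1) * ε - ε ≤ y
            linarith
          · change y ≤ a + (2 * k + 1) * ε + ε
            linarith [hy.2]
      calc F.real (Ioc a (a + 2 * (k + 1) * ε))
          ≤ F.real (Ioc a (a + 2 * k * ε)) + F.real (Icc (z.re - z.im) (z.re + z.im)) :=
            (measureReal_mono hsub).trans (measureReal_union_le _ _)
        _ ≤ k * (2 * ε * (δ / (b - a))) + 2 * ε * (δ / (b - a)) :=
            add_le_add (ih (by omega)) (hm.trans
              (mul_le_mul_of_nonneg_left hz (by positivity : 0 ≤ 2 * ε)))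
        _ = (k + 1) * (2 * ε * (δ / (b - a))) := by ring
  have := step n le_rfl
  rw [hnε] at this
  refine this.trans_eq ?_
  rw [hε]
  field_simp

omit [IsProbabilityMeasure F] in
theorem ae_le_abs_sub {x δ : ℝ} (hF : F (Ioo (x - δ) (x + δ)) = 0) : ∀ᵐ y ∂F, δ ≤ |x - y| := by
  have : ∀ᵐ y ∂F, y ∉ Ioo (x - δ) (x + δ) := measure_eq_zero_iff_ae_notMem.1 hF
  filter_upwards [this] with y hy
  by_contra! h
  rw [abs_lt] at h
  exact hy ⟨by linarith, by linarith⟩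

theorem abs_im_cauchyTransform_le {δ : ℝ} (hδ : 0 < δ) (hz : 0 < z.im)
    (hF : F (Ioo (z.re - δ) (z.re + δ)) = 0) : |(cauchyTransform F z).im| ≤ z.im / δ ^ 2 := by
  rw [cauchyTransform_im hz, abs_neg]
  have := norm_integral_le_of_norm_le_const (μ := F)
    (f := fun x : ℝ ↦ z.im / ((z.re - x) ^ 2 + z.im ^ 2)) (C := z.im / δ ^ 2) (by
      filter_upwards [ae_le_abs_sub hF] with y hy
      have h1 : δ ^ 2 ≤ (z.re - y) ^ 2 := by
        rw [← sq_abs (z.re - y)]; gcongr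
      rw [Real.norm_of_nonneg (by positivity)]
      gcongr
      nlinarith)
  simpa using this

/-- Up the imaginary axis, `z G(z)` recovers the mass at the origin. -/
theorem tendsto_mul_cauchyTransform {ε : ℕ → ℝ} (hε : ∀ n, 0 < ε n)
    (hlim : Tendsto ε atTop (𝓝 0)) :
    Tendsto (fun n ↦ (ε n * Complex.I) * cauchyTransform F (ε n * Complex.I)) atTop
      (𝓝 (F.real {0} : ℂ)) := by
  have hval : ∫ x : ℝ, ({0} : Set ℝ).indicator (fun _ ↦ (1 : ℂ)) x ∂F = (F.real {0} : ℂ) := by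
    rw [integral_indicator_const _ (measurableSet_singleton _)]
    simp
  rw [← hval]
  simp_rw [cauchyTransform, ← integral_const_mul]
  -- The integrand iε / (iε - x) has modulus at most 1 and tends to the indicator of {0}.
  refine tendsto_integral_of_dominated_convergence (fun _ ↦ (1 : ℝ))
    (fun n ↦ by measurability)
    (integrable_const _) (fun n ↦ ae_of_all _ fun x ↦ ?_) (ae_of_all _ fun x ↦ ?_)
  · have h1 : ‖(ε n * Complex.I : ℂ)‖ = ε n := by simp [abs_of_pos (hε n)]
    rw [norm_mul, h1]
    have h2 := norm_one_div_sub_ofReal_le (z := ε n * Complex.I) (by simpa using hε n) x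
    have h3 := mul_le_mul_of_nonneg_left h2 (hε n).le
    have h4 : ε n * (1 / (ε n * Complex.I : ℂ).im) = 1 := by
      simp [(hε n).ne']
    linarith
  · rcases eq_or_ne x 0 with rfl | hx
    · refine tendsto_const_nhds.congr fun n ↦ ?_
      have : (ε n : ℂ) ≠ 0 := by exact_mod_cast (hε n).ne'
      simp
      field_simp
      simp
    · rw [indicator_of_notMem (by simpa using hx)]
      have hl : Tendsto (fun n ↦ (ε n * Complex.I : ℂ)) atTop (𝓝 0) := by
        have := (Complex.continuous_ofReal.tendsto 0).comp hlim
        simpa using this.mul_const Complex.I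
      have hx' : (0 : ℂ) - x ≠ 0 := by simpa using hx
      simpa using hl.mul ((tendsto_const_nhds (x := (1 : ℂ))).div (hl.sub_const (x : ℂ)) hx')

end CauchyTransform

/-! ### Limits of roots -/

theorem norm_le_of_cubic_eq_zero {a b c d y : ℂ} (ha : a ≠ 0)
    (h : a * y ^ 3 + b * y ^ 2 + c * y + d = 0) : ‖y‖ ≤ 1 + (‖b‖ + ‖c‖ + ‖d‖) / ‖a‖ := by
  have ha' : 0 < ‖a‖ := norm_pos_iff.2 ha
  rcases le_or_gt ‖y‖ 1 with h1 | h1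
  · have : 0 ≤ (‖b‖ + ‖c‖ + ‖d‖) / ‖a‖ := by positivity
    linarith
  · have e : a * y ^ 3 = -(b * y ^ 2 + c * y + d) := by linear_combination h
    have h2 : ‖a‖ * ‖y‖ ^ 3 ≤ ‖b‖ * ‖y‖ ^ 2 + ‖c‖ * ‖y‖ + ‖d‖ := by
      rw [← norm_pow, ← norm_mul, e, norm_neg, ← norm_pow, ← norm_mul, ← norm_mul]
      exact norm_add₃_le
    have h3 : ‖y‖ ≤ ‖y‖ ^ 2 := by nlinarith
    have h4 : 1 ≤ ‖y‖ ^ 2 := by nlinarith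
    have h5 := mul_le_mul_of_nonneg_left h3 (norm_nonneg c)
    have h6 := mul_le_mul_of_nonneg_left h4 (norm_nonneg d)
    have h7 : ‖y‖ ≤ (‖b‖ + ‖c‖ + ‖d‖) / ‖a‖ := by
      rw [le_div_iff₀ ha']
      refine le_of_mul_le_mul_right (a := ‖y‖ ^ 2) ?_ (by positivity)
      nlinarith
    linarith

theorem norm_le_of_quadratic_eq_zero {b c d y : ℂ} (hb : b ≠ 0)
    (h : b * y ^ 2 + c * y + d = 0) : ‖y‖ ≤ 1 + (‖c‖ + ‖d‖) / ‖b‖ := by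
  have := norm_le_of_cubic_eq_zero (y := y) (b := c) (c := d) (d := 0) hb
    (by linear_combination y * h)
  simpa using this

/-- Roots of a convergent sequence of polynomials of degree two or three have a subsequence that
converges to a root of the limit. -/
theorem exists_subseq_tendsto_root {P : ℂ → Cubic ℂ} (hPa : Continuous fun z ↦ (P z).a)
    (hPb : Continuous fun z ↦ (P z).b) (hPc : Continuous fun z ↦ (P z).c)
    (hPd : Continuous fun z ↦ (P z).d) {x : ℂ}
    (hx : (P x).a ≠ 0 ∨ (∀ z, (P z).a = 0) ∧ (P x).b ≠ 0)
    {u y : ℕ → ℂ} (hu : Tendsto u atTop (𝓝 x)) (hy : ∀ n, (P (u n)).toPoly.eval (y n) = 0) :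
    ∃ g, ∃ φ : ℕ → ℕ, StrictMono φ ∧ Tendsto (y ∘ φ) atTop (𝓝 g) ∧
      (P x).toPoly.eval g = 0 := by
  simp_rw [Cubic.eval_toPoly] at hy ⊢
  have ta := (hPa.tendsto x).comp hu
  have tb := (hPb.tendsto x).comp hu
  have tc := (hPc.tendsto x).comp hu
  have td := (hPd.tendsto x).comp hu
  obtain ⟨N, hN⟩ : ∃ N, ∀ᶠ n in atTop, ‖y n‖ ≤ N := by
    -- A root could escape to infinity if the leading coefficient tended to 0 without vanishing
    -- identically; both alternatives exclude this. The second serves t = 0.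
    rcases hx with ha | ⟨ha, hb⟩
    · have hlim := (tendsto_const_nhds (x := (1 : ℝ))).add
        (((tb.norm.add tc.norm).add td.norm).div ta.norm (norm_ne_zero_iff.2 ha))
      obtain ⟨N, hN⟩ := hlim.isBoundedUnder_le
      refine ⟨N, ?_⟩
      filter_upwards [eventually_map.1 hN, ta.eventually_ne ha] with n h1 h2
      exact (norm_le_of_cubic_eq_zero h2 (hy n)).trans h1
    · have hlim := (tendsto_const_nhds (x := (1 : ℝ))).add
        ((tc.norm.add td.norm).div tb.norm (norm_ne_zero_iff.2 hb))
      obtain ⟨N, hN⟩ := hlim.isBoundedUnder_le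
      refine ⟨N, ?_⟩
      filter_upwards [eventually_map.1 hN, tb.eventually_ne hb] with n h1 h2
      refine (norm_le_of_quadratic_eq_zero h2 ?_).trans h1
      have := hy n
      rw [ha] at this
      simpa using this
  obtain ⟨g, -, φ, hφ, hg⟩ := tendsto_subseq_of_frequently_bounded
    (Metric.isBounded_closedBall (x := (0 : ℂ)) (r := N))
    (x := y) (hN.mono fun n hn ↦ by simpa using hn).frequently
  refine ⟨g, φ, hφ, hg, ?_⟩
  have hφt := hφ.tendsto_atTop
  have hlim := ((((ta.comp hφt).mul (hg.pow 3)).add ((tb.comp hφt).mul (hg.pow 2))).add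
    ((tc.comp hφt).mul hg)).add (td.comp hφt)
  refine tendsto_nhds_unique hlim (tendsto_const_nhds.congr fun n ↦ ?_)
  exact (hy (φ n)).symm

theorem Complex.tendsto_ofReal_of_re_im {u : ℕ → ℂ} {x : ℝ}
    (hre : Tendsto (fun n ↦ (u n).re) atTop (𝓝 x)) (him : Tendsto (fun n ↦ (u n).im) atTop (𝓝 0)) :
    Tendsto u atTop (𝓝 (x : ℂ)) := by
  have h := ((Complex.continuous_ofReal.tendsto x).comp hre).add
    (((Complex.continuous_ofReal.tendsto 0).comp him).mul_const Complex.I)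
  simpa [Complex.re_add_im] using h

theorem exists_pos_seq_tendsto_zero : ∃ ε : ℕ → ℝ, (∀ n, 0 < ε n) ∧ Tendsto ε atTop (𝓝 0) :=
  ⟨fun n ↦ 1 / ((n : ℝ) + 1), fun _ ↦ Nat.one_div_pos_of_nat,
    tendsto_one_div_add_atTop_nhds_zero_nat⟩

/-! ### The support away from the origin -/

namespace IsMarchenkoPastur

variable {c r s t : ℝ} {F : Measure ℝ}

theorem exists_subseq_tendsto_cauchyTransform (hF : IsMarchenkoPastur c (populationLaw r s t) F)
    (hc : 0 < c) (hr0 : 0 < r) (hr1 : r < 1) (hs : 0 < s) (ht : 0 ≤ t) {x : ℝ} (hx : x ≠ 0)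
    {u : ℕ → ℂ} (hu : Tendsto u atTop (𝓝 x)) (hu0 : ∀ n, 0 < (u n).im) :
    ∃ g, ∃ φ : ℕ → ℕ, StrictMono φ ∧ Tendsto (fun n ↦ cauchyTransform F (u (φ n))) atTop (𝓝 g) ∧
      ((mpCubic c r s t x).map Complex.ofRealHom).toPoly.eval g = 0 := by
  rw [← mpCubic_map_ofReal]
  refine exists_subseq_tendsto_root (P := fun z ↦ mpCubic (c : ℂ) r s t z)
    (y := fun n ↦ cauchyTransform F (u n)) ?_ ?_ ?_ ?_ ?_ hu
    fun n ↦ hF.eval_cauchyTransform hr0.le hr1.le (hu0 n)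
  · simp only [mpCubic]; fun_prop
  · simp only [mpCubic]; fun_prop
  · simp only [mpCubic]; fun_prop
  · simp only [mpCubic]; fun_prop
  · simp only [mpCubic_map_ofReal c r s t x]
    rcases ht.eq_or_lt with rfl | ht
    · refine Or.inr ⟨fun z ↦ by simp [mpCubic], ?_⟩
      have h := (mpCubic_a_or_b_ne_zero (c := c) (r := r) hc hs le_rfl hx).resolve_left
        (by rw [mpCubic_a_zero]; simp)
      simpa [Cubic.map] using h
    · have h := (mpCubic_a_pos (c := c) (r := r) hc hs ht hx).ne'
      left
      simpa [Cubic.map] using h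

/-- An interval that misses the origin and on which the discriminant is nonnegative has no mass. -/
theorem measure_Ioc_eq_zero (hF : IsMarchenkoPastur c (populationLaw r s t) F) (hc : 0 < c)
    (hr0 : 0 < r) (hr1 : r < 1) (hs : 0 < s) (ht : 0 ≤ t) {a b : ℝ} (h0 : 0 ∉ Icc a b)
    (hdisc : ∀ x ∈ Icc a b, 0 ≤ (discrPoly c r s t).eval x) : F (Ioc a b) = 0 := by
  have := hF.isProbabilityMeasure
  refine measure_Ioc_eq_zero_of_im_cauchyTransform ?_
  by_contra! H
  obtain ⟨η, hη, H⟩ := H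
  -- If uniformity fails, there are points approaching the real line with -Im G > η; a limit point
  -- of G along them would be a nonreal root.
  choose z hz hz0 hzε hzη using fun n : ℕ ↦ H (1 / (n + 1)) Nat.one_div_pos_of_nat
  obtain ⟨x, hx, ψ, hψ, hlim⟩ := isCompact_Icc.tendsto_subseq hz
  have him : Tendsto (fun n ↦ (z n).im) atTop (𝓝 0) :=
    tendsto_of_tendsto_of_tendsto_of_le_of_le tendsto_const_nhds
      tendsto_one_div_add_atTop_nhds_zero_nat (fun n ↦ (hz0 n).le) fun n ↦ (hzε n).le
  have hu : Tendsto (fun n ↦ z (ψ n)) atTop (𝓝 (x : ℂ)) :=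
    Complex.tendsto_ofReal_of_re_im hlim (him.comp hψ.tendsto_atTop)
  have hx0 : x ≠ 0 := by rintro rfl; exact h0 hx
  obtain ⟨g, φ, -, hg, hroot⟩ :=
    hF.exists_subseq_tendsto_cauchyTransform hc hr0 hr1 hs ht hx0 hu fun n ↦ hz0 _
  have hgim := Cubic.im_root_eq_zero (mpCubic_a_or_b_ne_zero hc hs ht hx0)
    (by rw [← eval_discrPoly_eq_discr]; exact hdisc x hx) hroot
  have h1 := ((Complex.continuous_im.tendsto g).comp hg).neg
  have h2 := ge_of_tendsto' h1 fun n ↦ (hzη (ψ (φ n))).le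
  rw [hgim] at h2
  linarith

theorem notMem_support_of_ne_zero (hF : IsMarchenkoPastur c (populationLaw r s t) F) (hc : 0 < c)
    (hr0 : 0 < r) (hr1 : r < 1) (hs : 0 < s) (ht : 0 ≤ t) {x : ℝ} (hx : x ≠ 0)
    (hdisc : x ∉ closure {x : ℝ | 0 ≤ x ∧ (discrPoly c r s t).eval x < 0}) : x ∉ F.support := by
  have hU : ({0}ᶜ ∩ (closure {x : ℝ | 0 ≤ x ∧ (discrPoly c r s t).eval x < 0})ᶜ) ∈ 𝓝 x :=
    inter_mem (isOpen_compl_singleton.mem_nhds hx) (isClosed_closure.isOpen_compl.mem_nhds hdisc)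
  obtain ⟨a, b, hab, hnhds, hsub⟩ := exists_Icc_mem_subset_of_mem_nhds hU
  rw [Measure.notMem_support_iff_exists]
  obtain ⟨ha, hb⟩ := Icc_mem_nhds_iff.1 hnhds
  refine ⟨Ioc a b, Ioc_mem_nhds ha hb, hF.measure_Ioc_eq_zero hc hr0 hr1 hs ht
    (fun h ↦ (hsub h).1 rfl) fun y hy ↦ ?_⟩
  rcases lt_or_ge y 0 with h | h
  · exact discrPoly_eval_nonneg_of_neg hc hr0 hr1 hs ht h
  · by_contra! h'
    exact (hsub hy).2 (subset_closure ⟨h, h'⟩)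

theorem closure_subset_Ici (c r s t : ℝ) :
    closure {x : ℝ | 0 ≤ x ∧ (discrPoly c r s t).eval x < 0} ⊆ Ici 0 :=
  closure_minimal (fun _ h ↦ h.1) isClosed_Ici

theorem ae_nonneg (hF : IsMarchenkoPastur c (populationLaw r s t) F) (hc : 0 < c)
    (hr0 : 0 < r) (hr1 : r < 1) (hs : 0 < s) (ht : 0 ≤ t) : ∀ᵐ x ∂F, 0 ≤ x := by
  filter_upwards [Measure.support_mem_ae (μ := F)] with x hx
  by_contra! h
  exact hF.notMem_support_of_ne_zero hc hr0 hr1 hs ht h.ne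
    (fun h' ↦ h.not_ge (closure_subset_Ici c r s t h')) hx

theorem exists_Ioo_null {F : Measure ℝ} {x : ℝ} (hx : x ∉ F.support) :
    ∃ δ > 0, F (Ioo (x - δ) (x + δ)) = 0 := by
  obtain ⟨U, hU, h0⟩ := Measure.notMem_support_iff_exists.1 hx
  obtain ⟨δ, hδ, hsub⟩ := Metric.mem_nhds_iff.1 hU
  exact ⟨δ, hδ, measure_mono_null (Real.ball_eq_Ioo x δ ▸ hsub) h0⟩

theorem mem_support_of_eval_neg (hF : IsMarchenkoPastur c (populationLaw r s t) F) (hc : 0 < c)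
    (hr0 : 0 < r) (hr1 : r < 1) (hs : 0 < s) (ht : 0 ≤ t) {x : ℝ} (hx : 0 ≤ x)
    (hdisc : (discrPoly c r s t).eval x < 0) : x ∈ F.support := by
  have := hF.isProbabilityMeasure
  -- Both leading coefficients of the cubic vanish at x = 0, hence so does the discriminant.
  have hx0 : 0 < x := by
    refine hx.lt_of_ne ?_
    rintro rfl
    rw [discrPoly_eval] at hdisc
    simp [mpCubic] at hdisc
  by_contra hsupp
  obtain ⟨δ, hδ, hnull⟩ := exists_Ioo_null hsupp
  obtain ⟨ε, hε, hε0⟩ := exists_pos_seq_tendsto_zero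
  set u : ℕ → ℂ := fun n ↦ x + ε n * Complex.I
  have hre (n : ℕ) : (u n).re = x := by simp [u]
  have him (n : ℕ) : (u n).im = ε n := by simp [u]
  have hpos (n : ℕ) : 0 < (u n).im := by rw [him]; exact hε n
  have him0 : Tendsto (fun n ↦ (u n).im) atTop (𝓝 0) := by simpa only [him] using hε0
  have hu : Tendsto u atTop (𝓝 (x : ℂ)) :=
    Complex.tendsto_ofReal_of_re_im (by simp [hre]) him0
  obtain ⟨g, φ, hφ, hg, hroot⟩ :=
    hF.exists_subseq_tendsto_cauchyTransform hc hr0 hr1 hs ht hx0.ne' hu hpos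
  have hgim : g.im = 0 := by
    refine tendsto_nhds_unique ((Complex.continuous_im.tendsto g).comp hg) ?_
    refine squeeze_zero_norm (a := fun n ↦ (u (φ n)).im / δ ^ 2) (fun n ↦ ?_) ?_
    · exact abs_im_cauchyTransform_le hδ (hpos _) (by rw [hre]; exact hnull)
    · simpa using (him0.comp hφ.tendsto_atTop).div_const (δ ^ 2)
  obtain ⟨y, rfl⟩ : ∃ y : ℝ, g = y := ⟨g.re, by apply Complex.ext <;> simp [hgim]⟩
  have huφ := hu.comp hφ.tendsto_atTop
  have hW : Tendsto (fun n ↦ mpFactor c F (u (φ n))) atTop (𝓝 ((1 - c + c * x * y : ℝ) : ℂ)) := by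
    have := ((huφ.const_mul (c : ℂ)).mul hg).const_add (1 - (c : ℂ))
    simpa [mpFactor] using this
  have hN (τ : ℝ) : Tendsto (fun n ↦ Complex.normSq (u (φ n) - τ * mpFactor c F (u (φ n)))) atTop
      (𝓝 ((x - τ * (1 - c + c * x * y)) ^ 2)) := by
    have := (Complex.continuous_normSq.tendsto _).comp (huφ.sub (hW.const_mul (τ : ℂ)))
    rw [← Complex.ofReal_mul, ← Complex.ofReal_sub, Complex.normSq_ofReal, ← pow_two] at this
    exact this
  have hNW := (Complex.continuous_normSq.tendsto _).comp hW
  rw [Complex.normSq_ofReal, ← pow_two] at hNW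
  have hN1 := hN t
  have hN2 := hN (s + t)
  push_cast at hN2
  -- The bound survives the limit as a weak inequality, with squared moduli now real squares.
  have hle := le_of_tendsto_of_tendsto'
    ((hNW.const_mul c).mul ((hN2.const_mul ((1 - r) * t ^ 2)).add
      (hN1.const_mul (r * (s + t) ^ 2)))) (hN1.mul hN2)
    fun n ↦ hF.normSq_mpFactor_le hr0.le hr1.le (hpos (φ n))
  refine mpCubic_eval_ne_zero_of_le hc hr0 hr1 hs ht hx0 hdisc rfl hle ?_
  rw [Cubic.map_toPoly] at hroot
  have : Complex.ofRealHom ((mpCubic c r s t x).toPoly.eval y) = 0 := by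
    rw [← hroot, ← Polynomial.eval_map_apply]; rfl
  simpa using this

theorem closure_subset_support (hF : IsMarchenkoPastur c (populationLaw r s t) F) (hc : 0 < c)
    (hr0 : 0 < r) (hr1 : r < 1) (hs : 0 < s) (ht : 0 ≤ t) :
    closure {x : ℝ | 0 ≤ x ∧ (discrPoly c r s t).eval x < 0} ⊆ F.support :=
  closure_minimal (fun _ h ↦ hF.mem_support_of_eval_neg hc hr0 hr1 hs ht h.1 h.2)
    Measure.isClosed_support

/-! ### The origin -/

theorem measureReal_zero_eq_zero (hF : IsMarchenkoPastur c (populationLaw r s t) F)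
    (hr0 : 0 < r) (hr1 : r < 1) (hs : 0 < s) (ht : 0 < t) (hc : 0 < c) (hc1 : c ≤ 1) :
    F.real {0} = 0 := by
  have := hF.isProbabilityMeasure
  have hp : 0 ≤ F.real {0} := measureReal_nonneg
  set p := F.real {0}
  -- 1 - c + c p is the limit of W. If it is 0, both nonnegative summands 1 - c and c p vanish; if
  -- not, G has a finite limit and z G tends to 0.
  rcases eq_or_ne (1 - c + c * p) 0 with h0 | h0
  · have : c * p = 0 := le_antisymm (by linarith) (by positivity)
    exact (mul_eq_zero.1 this).resolve_left hc.ne'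
  obtain ⟨ε, hε, hε0⟩ := exists_pos_seq_tendsto_zero
  have hlim := tendsto_mul_cauchyTransform (F := F) hε hε0
  set u : ℕ → ℂ := fun n ↦ ε n * Complex.I
  have hpos (n : ℕ) : 0 < (u n).im := by simpa [u] using hε n
  change Tendsto (fun n ↦ u n * cauchyTransform F (u n)) atTop _ at hlim
  have hu : Tendsto u atTop (𝓝 0) := by
    have := ((Complex.continuous_ofReal.tendsto 0).comp hε0).mul_const Complex.I
    simpa [u] using this
  have hW : Tendsto (fun n ↦ mpFactor c F (u n)) atTop (𝓝 ((1 - c + c * p : ℝ) : ℂ)) := by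
    have := (hlim.const_mul (c : ℂ)).const_add (1 - (c : ℂ))
    simpa only [mpFactor, mul_assoc, Complex.ofReal_add, Complex.ofReal_sub, Complex.ofReal_mul,
      Complex.ofReal_one] using this
  have hden {τ : ℝ} (hτ : 0 < τ) : Tendsto (fun n ↦ u n - τ * mpFactor c F (u n)) atTop
      (𝓝 (0 - τ * ((1 - c + c * p : ℝ) : ℂ))) := hu.sub (hW.const_mul _)
  have hne {τ : ℝ} (hτ : 0 < τ) : (0 - τ * ((1 - c + c * p : ℝ) : ℂ)) ≠ 0 := by
    rw [zero_sub, neg_ne_zero, ← Complex.ofReal_mul]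
    exact_mod_cast mul_ne_zero hτ.ne' h0
  have hst : 0 < s + t := by linarith
  have h1 := hu.mul ((tendsto_const_nhds (x := (1 - r : ℂ))).div (hden ht) (hne ht) |>.add
    ((tendsto_const_nhds (x := (r : ℂ))).div (hden hst) (hne hst)))
  rw [zero_mul] at h1
  have h2 := tendsto_nhds_unique hlim (h1.congr fun n ↦ by
    rw [hF.cauchyTransform_eq hr0.le hr1.le (hpos n)]
    simp)
  exact_mod_cast h2

/-- A neighbourhood of 0 missing the closure meets the support at most in 0, which carries no mass.
-/
theorem zero_notMem_support (hF : IsMarchenkoPastur c (populationLaw r s t) F)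
    (hr0 : 0 < r) (hr1 : r < 1) (hs : 0 < s) (ht : 0 < t) (hc : 0 < c) (hc1 : c ≤ 1)
    (hdisc : 0 ∉ closure {x : ℝ | 0 ≤ x ∧ (discrPoly c r s t).eval x < 0}) : 0 ∉ F.support := by
  have := hF.isProbabilityMeasure
  rw [Measure.notMem_support_iff_exists]
  refine ⟨_, isClosed_closure.isOpen_compl.mem_nhds hdisc, ?_⟩
  refine measure_mono_null (t := F.supportᶜ ∪ {0}) (fun x hx ↦ ?_) (measure_union_null
    Measure.measure_compl_support
    ((measureReal_eq_zero_iff).1 (hF.measureReal_zero_eq_zero hr0 hr1 hs ht hc hc1)))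
  rcases eq_or_ne x 0 with rfl | h
  · exact Or.inr rfl
  · exact Or.inl (hF.notMem_support_of_ne_zero hc hr0 hr1 hs ht.le h hx)

theorem zero_mem_support (hF : IsMarchenkoPastur c (populationLaw r s t) F)
    (hr0 : 0 < r) (hr1 : r < 1) (hs : 0 < s) (ht : 0 ≤ t) (hc : 0 < c) (h : t = 0 ∨ 1 < c) :
    0 ∈ F.support := by
  have := hF.isProbabilityMeasure
  by_contra hsupp
  obtain ⟨δ, hδ, hnull⟩ := exists_Ioo_null hsupp
  have hzero : F.real {0} = 0 := by
    rw [measureReal_eq_zero_iff]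
    exact measure_mono_null (by simpa using hδ) hnull
  obtain ⟨ε, hε, hε0⟩ := exists_pos_seq_tendsto_zero
  have hlim := tendsto_mul_cauchyTransform (F := F) hε hε0
  rw [hzero] at hlim
  set u : ℕ → ℂ := fun n ↦ ε n * Complex.I
  have hre (n : ℕ) : (u n).re = 0 := by simp [u]
  have hpos (n : ℕ) : 0 < (u n).im := by simpa [u] using hε n
  have hu0 (n : ℕ) : u n ≠ 0 := by
    intro h
    have := hpos n
    simp [h] at this
  have hWdiv (n : ℕ) : mpFactor c F (u n) / u n =
      (1 - c : ℝ) / u n + c * cauchyTransform F (u n) := by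
    have := hu0 n
    rw [mpFactor]
    push_cast
    field_simp
  rcases h with rfl | hc1
  · have hre_le (n : ℕ) : (cauchyTransform F (u n)).re ≤ 0 := by
      rw [cauchyTransform_re (hpos n)]
      refine integral_nonpos_of_ae ?_
      filter_upwards [hF.ae_nonneg hc hr0 hr1 hs le_rfl] with x hx
      rw [hre]
      exact div_nonpos_of_nonpos_of_nonneg (by linarith) (by positivity)
    -- For t = 0, z G = (1 - r) + r / (1 - s q). As F lives on [0, ∞), Re q ≤ 0 on the imaginary
    -- axis, so the last term has nonnegative real part and the atom has mass at least 1 - r.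
    have hge (n : ℕ) : 1 - r ≤ (u n * cauchyTransform F (u n)).re := by
      set q := mpFactor c F (u n) / u n with hq
      have hqre : q.re ≤ 0 := by
        rw [hq, hWdiv, Complex.add_re, Complex.re_ofReal_mul, Complex.div_re, hre, Complex.ofReal_im]
        simpa using mul_nonpos_of_nonneg_of_nonpos hc.le (hre_le n)
      have heq : u n * cauchyTransform F (u n) = (1 - r : ℝ) + r * (1 - s * q)⁻¹ := by
        have h1 := hF.sub_mul_mpFactor_ne_zero (hpos n) s
        have hun := hu0 n
        have h2 : u n - s * mpFactor c F (u n) = u n * (1 - s * q) := by rw [hq]; field_simp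
        rw [h2] at h1
        have h3 := right_ne_zero_of_mul h1
        rw [hF.cauchyTransform_eq hr0.le hr1.le (hpos n)]
        simp only [Complex.ofReal_zero, zero_mul, add_zero, sub_zero]
        rw [h2]
        generalize 1 - s * q = d at *
        push_cast
        field_simp
      rw [heq, Complex.add_re, Complex.ofReal_re, Complex.re_ofReal_mul, Complex.inv_re]
      have : 0 ≤ (1 - s * q).re := by
        rw [Complex.sub_re, Complex.re_ofReal_mul, Complex.one_re]
        nlinarith
      have h4 : 0 ≤ r * ((1 - s * q).re / Complex.normSq (1 - s * q)) :=
        mul_nonneg hr0.le (div_nonneg this (Complex.normSq_nonneg _))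
      linarith
    have := ge_of_tendsto' ((Complex.continuous_re.tendsto _).comp hlim) hge
    simp at this
    linarith
  -- On the imaginary axis Im (W / z) < 0 means Re W > 0, so the atom has mass at least 1 - 1 / c.
  · have hge (n : ℕ) : c - 1 ≤ c * (u n * cauchyTransform F (u n)).re := by
      have h1 := hF.mpFactor_div_im_neg (hpos n)
      rw [Complex.div_im, hre, mul_zero, zero_div, zero_sub, neg_lt_zero] at h1
      have h2 : 0 < (mpFactor c F (u n)).re := by
        by_contra! h3
        exact h1.not_ge (div_nonpos_of_nonpos_of_nonneg
          (mul_nonpos_of_nonpos_of_nonneg h3 (hpos n).le) (Complex.normSq_nonneg _))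
      rw [mpFactor, mul_assoc, Complex.add_re, Complex.re_ofReal_mul] at h2
      simp only [Complex.sub_re, Complex.one_re, Complex.ofReal_re] at h2
      linarith
    have := ge_of_tendsto' (((Complex.continuous_re.tendsto _).comp hlim).const_mul c) hge
    simp at this
    linarith

end IsMarchenkoPastur

theorem lemma1 (c r s t : ℝ) (hc : 0 < c) (hr0 : 0 < r) (hr1 : r < 1) (hs : 0 < s) (ht : 0 ≤ t)
    (F : Measure ℝ) (hF : IsMarchenkoPastur c (populationLaw r s t) F) :
    (∀ z : ℂ, 0 < z.im →
      (mpCubic (c : ℂ) (r : ℂ) (s : ℂ) (t : ℂ) z).toPoly.eval (cauchyTransform F z) = 0) ∧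
    (0 < t → c ≤ 1 →
      F.support = closure {x : ℝ | 0 ≤ x ∧ (discrPoly c r s t).eval x < 0}) ∧
    (t = 0 ∨ 1 < c →
      F.support = insert 0 (closure {x : ℝ | 0 ≤ x ∧ (discrPoly c r s t).eval x < 0})) := by
  have hsub := hF.closure_subset_support hc hr0 hr1 hs ht
  refine ⟨fun z hz ↦ hF.eval_cauchyTransform hr0.le hr1.le hz, fun ht hc1 ↦ ?_, fun h ↦ ?_⟩
  · refine Subset.antisymm (fun x hx ↦ ?_) hsub
    by_contra hx'
    rcases eq_or_ne x 0 with rfl | h0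
    · exact hF.zero_notMem_support hr0 hr1 hs ht hc hc1 hx' hx
    · exact hF.notMem_support_of_ne_zero hc hr0 hr1 hs ht.le h0 hx' hx
  · refine Subset.antisymm (fun x hx ↦ ?_)
      (insert_subset (hF.zero_mem_support hr0 hr1 hs ht hc h) hsub)
    by_contra hx'
    rw [mem_insert_iff, not_or] at hx'
    exact hF.notMem_support_of_ne_zero hc hr0 hr1 hs ht hx'.1 hx'.2 hx
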